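/- **Setting.** A *cloner* with blank qubit state $b$ is a completely positive trace-preserving map $\Phi$ on two qubits; on an input qubit state $\rho$ it outputs $\sigma_\rho=\Phi(\rho\otimes b)$. For a pure input $\rho=|a\rangle\langle a|$ the *ideal clone* is $\rho\otimes\rho=|aa\rangle\langle aa|$ and the *global fidelity* is $\operatorname{tr}[(\rho\otimes\rho)\,\sigma_\rho]$. In *phase-covariant* cloning the inputs are the pure states on the equator of the Bloch sphere, in *universal* cloning all pure qubit states. A cloner is *optimal* if its global fidelity, averaged uniformly over the inputs, is maximal among all cloners with the same blank state. A *finite fragment* of two-qubit quantum theory consists of finitely many preparations $p$ with density operators $\rho_p$ and finitely many measurements $m$ with effects $(T_{m,k})_k$ for finitely many outcomes $k$ ($T_{m,k}\ge 0$, $\sum_kT_{m,k}=1$). Its COPE matrix is $C_{(m,k),p}=\operatorname{tr}(T_{m,k}\rho_p)$. An *ontological model* of it consists of a finite set $\Lambda$, probability distributions $\mu_p$ on $\Lambda$ and response functions $\xi_{m,k}\colon\Lambda\to[0,1]$ with $\sum_k\xi_{m,k}=1$, such that $C_{(m,k),p}=\sum_\lambda\xi_{m,k}(\lambda)\mu_p(\lambda)$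 for all $m,k,p$. It is *noncontextual* if any two probabilistic mixtures of preparations that no two-qubit effect separates have the same mixture of the $\mu_p$, and any two (sub-normalized) mixtures of outcome events that no two-qubit state separates have the same mixture of the $\xi_{m,k}$. **Theorem 4.** No noncontextual ontological model can achieve the optimal global fidelity of phase-covariant or of universal quantum cloning. Precisely: let $\Phi$ be an optimal phase-covariant (respectively universal) cloner with blank state $b$, and let $a_1,\dots,a_N$, $N\ge 12155$, be distinct pure qubit states on the equator of the Bloch sphere (respectively anywhere on the Bloch sphere). Consider any finite fragment of two-qubit quantum theory whose preparations include all ideal clones $a_i\otimes a_i$ and all optimal clones $\sigma_{a_i}$, and whose measurements include, for every $i$, one that has $a_i\otimes a_i$ among its effects; it may contain any further preparations and measurements, such as orthogonal complements of the ideal and of the optimal clones and measurements in the corresponding bases. Then every ontological model of this fragment is contextual, i.e. not noncontextual. Moreover, its COPE matrix $C$ admits no equirank nonnegative matrix factorization: there are no entrywise nonnegative real matrices $R,E$ with $C=RE$ and $\operatorname{rank}C=\operatorname{rank}R=\operatorname{rank}E$. -/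

import Mathlib

namespace QCloning

open scoped Kronecker ComplexOrder

noncomputable section

/-- Operators on one qubit. -/
abbrev Op1 := Matrix (Fin 2) (Fin 2) ℂ

/-- Operators on two qubits. -/
abbrev Op2 := Matrix (Fin 2 × Fin 2) (Fin 2 × Fin 2) ℂ

/-- Density operators. -/
def IsDensity {n : Type*} [Fintype n] (ρ : Matrix n n ℂ) : Prop :=
  ρ.PosSemidef ∧ ρ.trace = 1

/-- Effects, i.e. operators `0 ≤ T ≤ 1`. -/
def IsEffect {n : Type*} [Fintype n] [DecidableEq n] (T : Matrix n n ℂ) : Prop :=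
  T.PosSemidef ∧ (1 - T).PosSemidef

/-- The Born probability `tr (T ρ)`. -/
def born {n : Type*} [Fintype n] (T ρ : Matrix n n ℂ) : ℝ :=
  (T * ρ).trace.re

/-! ### The cloning task -/

/-- The rank-one operator `|ψ⟩⟨ψ|`. -/
def ketbra (ψ : Fin 2 → ℂ) : Op1 := Matrix.vecMulVec ψ (star ψ)

/-- The pure qubit state with polar angle `θ` and azimuth `φ` on the Bloch sphere:
`|ψ⟩ = cos (θ/2) |0⟩ + exp (i φ) sin (θ/2) |1⟩`. -/
def blochState (θ φ : ℝ) : Op1 :=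
  ketbra ![(Real.cos (θ / 2) : ℂ), Complex.exp (φ * Complex.I) * (Real.sin (θ / 2) : ℂ)]

/-- The ideal output `ρ ⊗ ρ` of a cloner. For a pure `ρ = |a⟩⟨a|` it is `|aa⟩⟨aa|`, and it is used
both as a state and as the effect that tests for it. -/
def idealClone (ρ : Op1) : Op2 := ρ ⊗ₖ ρ

/-- Completely positive trace-preserving maps on two qubits, in Kraus form. -/
def IsChannel (Φ : Op2 →ₗ[ℂ] Op2) : Prop :=
  ∃ (r : ℕ) (A : Fin r → Op2),
    ∑ k, (A k).conjTranspose * A k = 1 ∧ ∀ X, Φ X = ∑ k, A k * X * (A k).conjTranspose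

/-- The bipartite output of the cloner `Φ`, fed with the input `ρ` and the blank state `b`. -/
def cloneOutput (Φ : Op2 →ₗ[ℂ] Op2) (b ρ : Op1) : Op2 := Φ (ρ ⊗ₖ b)

/-- The global fidelity of the output with the ideal clone of a pure input `ρ`. -/
def globalFidelity (Φ : Op2 →ₗ[ℂ] Op2) (b ρ : Op1) : ℝ :=
  born (idealClone ρ) (cloneOutput Φ b ρ)

/-- The two families of cloning tasks. -/
inductive Task where
  | phaseCovariant
  | universal

/-- The set of inputs: the equator of the Bloch sphere, or all pure qubit states. -/
def Task.inputs : Task → Set Op1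
  | .phaseCovariant => {ρ | ∃ φ : ℝ, ρ = blochState (Real.pi / 2) φ}
  | .universal => {ρ | ∃ ψ : Fin 2 → ℂ, ∑ i, ‖ψ i‖ ^ 2 = 1 ∧ ρ = ketbra ψ}

/-- The global fidelity averaged uniformly over the set of inputs. -/
def Task.averageFidelity (t : Task) (Φ : Op2 →ₗ[ℂ] Op2) (b : Op1) : ℝ :=
  match t with
  | .phaseCovariant =>
      (2 * Real.pi)⁻¹ * ∫ φ in (0 : ℝ)..(2 * Real.pi),
        globalFidelity Φ b (blochState (Real.pi / 2) φ)
  | .universal =>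
      (4 * Real.pi)⁻¹ * ∫ θ in (0 : ℝ)..Real.pi, ∫ φ in (0 : ℝ)..(2 * Real.pi),
        globalFidelity Φ b (blochState θ φ) * Real.sin θ

/-- `Φ` is a physical cloner whose global fidelity is the maximum that quantum theory allows. -/
def Task.IsOptimalCloner (t : Task) (Φ : Op2 →ₗ[ℂ] Op2) (b : Op1) : Prop :=
  IsChannel Φ ∧ ∀ Ψ, IsChannel Ψ → t.averageFidelity Ψ b ≤ t.averageFidelity Φ b

/-! ### Prepare-measure fragments of two-qubit quantum theory -/

/-- Preparations `P` and measurements `M` with outcomes `K`, realised by two-qubit density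
operators and positive operator valued measures. -/
structure Fragment (P M K : Type*) [Fintype K] where
  state : P → Op2
  effect : M → K → Op2
  state_density : ∀ p, IsDensity (state p)
  effect_pos : ∀ m k, (effect m k).PosSemidef
  effect_sum : ∀ m, ∑ k, effect m k = 1

variable {P M K : Type*} [Fintype P] [Fintype M] [Fintype K]

/-- The matrix of conditional outcome probabilities of events: rows are the outcome events,
columns the preparations. -/
def Fragment.cope (F : Fragment P M K) : Matrix (M × K) P ℝ :=
  Matrix.of fun e p => born (F.effect e.1 e.2) (F.state p)

/-- The fragment contains the cloning task for the inputs `a i`: it prepares the ideal clones and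
the actual outputs of the cloner, and for each input has a measurement in which one of the outcomes
is the test of the ideal clone. Any further preparations and measurements are allowed. -/
structure Fragment.ContainsCloning (F : Fragment P M K) (Φ : Op2 →ₗ[ℂ] Op2) (b : Op1)
    {N : ℕ} (a : Fin N → Op1) : Prop where
  ideal : ∀ i, ∃ p, F.state p = idealClone (a i)
  clone : ∀ i, ∃ p, F.state p = cloneOutput Φ b (a i)
  test : ∀ i, ∃ m k, F.effect m k = idealClone (a i)

/-- Mixtures `w`, `w'` of preparations of the fragment are operationally equivalent: no effect of
two-qubit quantum theory separates them. -/
def Fragment.PrepEquiv (F : Fragment P M K) (w w' : P → ℝ) : Prop :=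
  ∀ T, IsEffect T → ∑ p, w p * born T (F.state p) = ∑ p, w' p * born T (F.state p)

/-- Mixtures `w`, `w'` of outcome events of the fragment are operationally equivalent: no two-qubit
state separates them. -/
def Fragment.EventEquiv (F : Fragment P M K) (w w' : M × K → ℝ) : Prop :=
  ∀ ρ, IsDensity ρ →
    ∑ e, w e * born (F.effect e.1 e.2) ρ = ∑ e, w' e * born (F.effect e.1 e.2) ρ

/-! ### Ontological models -/

/-- An ontological model over the finite ontic space `Λ` that reproduces the statistics. -/
structure OntologicalModel (F : Fragment P M K) (Λ : Type*) [Fintype Λ] where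
  epistemic : Matrix Λ P ℝ
  response : Matrix (M × K) Λ ℝ
  epistemic_nonneg : ∀ l p, 0 ≤ epistemic l p
  epistemic_sum : ∀ p, ∑ l, epistemic l p = 1
  response_nonneg : ∀ e l, 0 ≤ response e l
  response_sum : ∀ m l, ∑ k, response (m, k) l = 1
  reproduces : F.cope = response * epistemic

/-- Operationally equivalent procedures have the same representation. A procedure is a preparation
drawn at random with probabilities `w`, respectively an outcome event drawn at random with
probabilities `w` (and no event with probability `1 - ∑ w`). -/
structure OntologicalModel.IsNoncontextual {F : Fragment P M K} {Λ : Type*} [Fintype Λ]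
    (O : OntologicalModel F Λ) : Prop where
  prep : ∀ w w' : P → ℝ, (∀ p, 0 ≤ w p) → (∀ p, 0 ≤ w' p) → ∑ p, w p = 1 → ∑ p, w' p = 1 →
    F.PrepEquiv w w' → ∀ l, ∑ p, w p * O.epistemic l p = ∑ p, w' p * O.epistemic l p
  event : ∀ w w' : M × K → ℝ, (∀ e, 0 ≤ w e) → (∀ e, 0 ≤ w' e) → ∑ e, w e ≤ 1 → ∑ e, w' e ≤ 1 →
    F.EventEquiv w w' → ∀ l, ∑ e, w e * O.response e l = ∑ e, w' e * O.response e l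

/-- Equirank nonnegative matrix factorizations. -/
def AdmitsENMF {m n : Type*} [Fintype n] (C : Matrix m n ℝ) : Prop :=
  ∃ (s : ℕ) (R : Matrix m (Fin s) ℝ) (E : Matrix (Fin s) n ℝ),
    (∀ i l, 0 ≤ R i l) ∧ (∀ l j, 0 ≤ E l j) ∧ C = R * E ∧ C.rank = R.rank ∧ C.rank = E.rank

end

end QCloning

namespace QCloning

open scoped Kronecker ComplexOrder

/-! ### Linear algebra -/

/-! Noncontextuality, or equality of ranks, makes both factors respect the linear relations among
states and effects. So every ontic `l` carries real linear functionals: `ε l`, giving the epistemic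
weights of states, and `r l`, giving the responses to effects (`exists_functional_of_relations`).

Write `v i` for the i-th ideal clone. Its test succeeds on it with certainty, and a vanishing sum of
nonnegative terms has vanishing terms. Hence for every `l`, either `ε l` or the defect `δ l = r l 1
• tr - r l` is zero at `v i`. Both are linear in `v i`, and the clones span dimension at most 10
because they are symmetric tensors (`finrank_span_idealClone_le`).

If for some `l` neither functional vanishes on the whole family, their zero sets cover the family
and span proper subspaces; the larger one keeps at least half of the points and loses a dimension.
Starting from more than `2 ^ 9` clones, this stops with at least two distinct clones left
(`exists_subset_forall_vanish`). For these, every `l` has one functional vanishing on both, so the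
test of one is certain on the other, and the two pure states coincide. -/

/-- A real function on a finite family of vectors that respects its linear relations extends to a
linear functional. -/
theorem exists_functional_of_relations {ι V : Type*} [Fintype ι] [AddCommGroup V] [Module ℝ V]
    (x : ι → V) (g : ι → ℝ)
    (h : ∀ w : ι → ℝ, ∑ i, w i • x i = 0 → ∑ i, w i * g i = 0) :
    ∃ f : V →ₗ[ℝ] ℝ, ∀ i, f (x i) = g i := by
  classical
  have hg : Fintype.linearCombination ℝ g ∈
      (LinearMap.ker (Fintype.linearCombination ℝ x)).dualAnnihilator := by
    rw [Submodule.mem_dualAnnihilator]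
    intro w hw
    simpa [Fintype.linearCombination_apply] using
      h w (by simpa [Fintype.linearCombination_apply] using hw)
  -- A functional that kills the kernel of `w ↦ ∑ i, w i • x i` factors through that map.
  rw [← LinearMap.range_dualMap_eq_dualAnnihilator_ker] at hg
  obtain ⟨f, hf⟩ := hg
  refine ⟨f, fun i => ?_⟩
  have := LinearMap.congr_fun hf (Pi.single i 1)
  simpa [LinearMap.dualMap_apply, Fintype.linearCombination_apply_single] using this

/-- If each point of a finite set is a zero of `e l` or of `h l`, for every `l`, then two of the
points lie in a subset on which one of `e l`, `h l` vanishes identically, for every `l`, provided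
that the set is large compared with the dimension of its span. -/
theorem exists_subset_forall_vanish {ι Λ V : Type*} [AddCommGroup V] [Module ℝ V]
    [FiniteDimensional ℝ V] (v : ι → V) (hv : ∀ i, v i ≠ 0) (e h : Λ → V →ₗ[ℝ] ℝ)
    (heh : ∀ l i, e l (v i) = 0 ∨ h l (v i) = 0) (d : ℕ) (A : Finset ι)
    (hd : Module.finrank ℝ (Submodule.span ℝ (v '' A)) ≤ d) (hA : 2 ^ d < 2 * A.card) :
    ∃ B : Finset ι, 1 < B.card ∧
      ∀ l, (∀ i ∈ B, e l (v i) = 0) ∨ (∀ i ∈ B, h l (v i) = 0) := by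
  classical
  induction d generalizing A with
  | zero =>
    obtain ⟨i, hi⟩ : A.Nonempty := Finset.card_pos.1 (by omega)
    have h0 := Submodule.finrank_eq_zero.1 (Nat.le_zero.1 hd)
    have : v i ∈ Submodule.span ℝ (v '' A) := Submodule.subset_span ⟨i, hi, rfl⟩
    rw [h0, Submodule.mem_bot] at this
    exact absurd this (hv i)
  | succ d ih =>
    by_cases hgood : ∀ l, (∀ i ∈ A, e l (v i) = 0) ∨ (∀ i ∈ A, h l (v i) = 0)
    · refine ⟨A, ?_, hgood⟩
      -- In dimension bound `d + 1` the hypothesis reads `2 ^ d < A.card`, which forces two points.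
      have := Nat.one_le_two_pow (n := d)
      rw [pow_succ] at hA
      omega
    · push Not at hgood
      obtain ⟨l, ⟨i, hi, hei⟩, j, hj, hhj⟩ := hgood
      -- The zeros of `f` span a subspace of its kernel, which misses `v k`, so the span shrinks
      -- strictly.
      have drop : ∀ (f : V →ₗ[ℝ] ℝ) (k : ι), k ∈ A → f (v k) ≠ 0 →
          Module.finrank ℝ (Submodule.span ℝ (v '' (A.filter fun i => f (v i) = 0))) ≤ d := by
        intro f k hk hfk
        refine Nat.le_of_lt_succ (lt_of_lt_of_le (Submodule.finrank_lt_finrank_of_lt ?_) hd)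
        refine lt_of_le_of_ne (Submodule.span_mono (Set.image_mono (by exact_mod_cast Finset.filter_subset _ A))) fun heq => hfk ?_
        have hk' : v k ∈ Submodule.span ℝ (v '' A) := Submodule.subset_span ⟨k, hk, rfl⟩
        rw [← heq] at hk'
        have hle : Submodule.span ℝ (v '' (A.filter fun i => f (v i) = 0)) ≤ LinearMap.ker f := by
          rw [Submodule.span_le]
          rintro _ ⟨m, hm, rfl⟩
          simpa using (Finset.mem_filter.1 hm).2
        exact hle hk'
      have hcover : A.card ≤
          (A.filter fun i => e l (v i) = 0).card + (A.filter fun i => h l (v i) = 0).card := by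
        refine le_trans (Finset.card_le_card fun m hm => ?_) (Finset.card_union_le _ _)
        simp only [Finset.mem_union, Finset.mem_filter]
        exact (heh l m).imp (⟨hm, ·⟩) (⟨hm, ·⟩)
      rw [pow_succ] at hA
      by_cases hlarge : 2 ^ d < 2 * (A.filter fun i => e l (v i) = 0).card
      · exact ih _ (drop _ i hi hei) hlarge
      · exact ih _ (drop _ j hj hhj) (by omega)

/-- In an equirank factorization `C = R * E`, the right factor has the kernel of `C`. -/
theorem mulVec_eq_zero_of_rank_eq {m s n : Type*} [Fintype s] [Fintype n] [DecidableEq n]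
    {C : Matrix m n ℝ} {R : Matrix m s ℝ} {E : Matrix s n ℝ}
    (hC : C = R * E) (hr : C.rank = E.rank) {w : n → ℝ} (hw : C.mulVec w = 0) :
    E.mulVec w = 0 := by
  have hle : LinearMap.ker E.mulVecLin ≤ LinearMap.ker C.mulVecLin := by
    intro x hx
    simp only [LinearMap.mem_ker, Matrix.mulVecLin_apply] at hx ⊢
    rw [hC, ← Matrix.mulVec_mulVec, hx, Matrix.mulVec_zero]
  have h1 := LinearMap.finrank_range_add_finrank_ker C.mulVecLin
  have h2 := LinearMap.finrank_range_add_finrank_ker E.mulVecLin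
  -- By rank-nullity, equal ranks give kernels of equal dimension, so the inclusion is an equality.
  have heq := Submodule.eq_of_le_of_finrank_eq hle (by
    unfold Matrix.rank at hr
    omega)
  have : w ∈ LinearMap.ker E.mulVecLin := by
    rw [heq]
    simpa using hw
  simpa using this

/-! ### Pure qubit states -/

/-- The Born pairing is linear in the effect. -/
theorem born_sum_smul_left {ι n : Type*} [Fintype ι] [Fintype n] (w : ι → ℝ)
    (T : ι → Matrix n n ℂ) (ρ : Matrix n n ℂ) :
    born (∑ i, w i • T i) ρ = ∑ i, w i * born (T i) ρ := by
  simp [born, Finset.sum_mul, Matrix.trace_sum]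

/-- The Born pairing is linear in the state. -/
theorem born_sum_smul_right {ι n : Type*} [Fintype ι] [Fintype n] (w : ι → ℝ)
    (T : Matrix n n ℂ) (ρ : ι → Matrix n n ℂ) :
    born T (∑ i, w i • ρ i) = ∑ i, w i * born T (ρ i) := by
  simp [born, Finset.mul_sum, Matrix.trace_sum]

/-- Pure states, i.e. Hermitian idempotents of trace one. -/
structure IsPure {n : Type*} [Fintype n] (ρ : Matrix n n ℂ) : Prop where
  herm : ρ.IsHermitian
  idem : ρ * ρ = ρ
  trace : ρ.trace = 1

theorem isPure_ketbra {ψ : Fin 2 → ℂ} (hψ : ∑ i, ‖ψ i‖ ^ 2 = 1) : IsPure (ketbra ψ) := by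
  have hdot : star ψ ⬝ᵥ ψ = 1 := by
    have : (((∑ i, ‖ψ i‖ ^ 2 : ℝ)) : ℂ) = 1 := by rw [hψ]; simp
    rw [← this]
    simp [dotProduct, Complex.conj_mul']
  refine ⟨?_, ?_, ?_⟩
  · simp [ketbra, Matrix.IsHermitian, Matrix.conjTranspose_vecMulVec]
  · rw [ketbra, Matrix.vecMulVec_mul_vecMulVec, hdot, one_smul]
  · rw [ketbra, Matrix.trace_vecMulVec, dotProduct_comm, hdot]

theorem isPure_of_mem_inputs {t : Task} {ρ : Op1} (h : ρ ∈ t.inputs) : IsPure ρ := by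
  cases t with
  | phaseCovariant =>
    obtain ⟨φ, rfl⟩ := h
    refine isPure_ketbra ?_
    simp only [Fin.sum_univ_two, Matrix.cons_val_zero, Matrix.cons_val_one, norm_mul,
      Complex.norm_exp_ofReal_mul_I, one_mul, Complex.norm_real, Real.norm_eq_abs, sq_abs]
    exact Real.cos_sq_add_sin_sq _
  | universal =>
    obtain ⟨ψ, hψ, rfl⟩ := h
    exact isPure_ketbra hψ

/-- Pure states with unit overlap coincide. -/
theorem IsPure.eq_of_trace_mul_eq_one {n : Type*} [Fintype n] {ρ σ : Matrix n n ℂ}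
    (hρ : IsPure ρ) (hσ : IsPure σ) (h : (ρ * σ).trace = 1) : ρ = σ := by
  -- The squared Hilbert–Schmidt distance is `1 - 2 * tr (ρ σ) + 1`.
  have h0 : ((ρ - σ).conjTranspose * (ρ - σ)).trace = 0 := by
    rw [Matrix.conjTranspose_sub, hρ.herm.eq, hσ.herm.eq]
    simp only [sub_mul, mul_sub, Matrix.trace_sub, hρ.idem, hσ.idem, hρ.trace, hσ.trace, h,
      Matrix.trace_mul_comm σ ρ]
    norm_num
  exact sub_eq_zero.1 (Matrix.trace_conjTranspose_mul_self_eq_zero_iff.1 h0)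

/-- The overlap is the squared Hilbert–Schmidt norm of `σ * ρ`. Its sign matters because a product
test reveals only the square of the overlap. -/
theorem IsPure.trace_mul_nonneg {n : Type*} [Fintype n] {ρ σ : Matrix n n ℂ}
    (hρ : IsPure ρ) (hσ : IsPure σ) : 0 ≤ (ρ * σ).trace := by
  have h : (ρ * σ).trace = ((σ * ρ).conjTranspose * (σ * ρ)).trace := by
    rw [Matrix.conjTranspose_mul, hρ.herm.eq, hσ.herm.eq, mul_assoc, ← mul_assoc σ, hσ.idem,
      Matrix.trace_mul_comm ρ (σ * ρ), mul_assoc, hρ.idem, Matrix.trace_mul_comm]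
  rw [h]
  exact (Matrix.posSemidef_conjTranspose_mul_self _).trace_nonneg

/-- The test of the ideal clone of a pure state is passed with certainty only by that clone. -/
theorem IsPure.eq_of_born_idealClone_eq_one {ρ σ : Op1} (hρ : IsPure ρ) (hσ : IsPure σ)
    (h : born (idealClone ρ) (idealClone σ) = 1) : ρ = σ := by
  refine hρ.eq_of_trace_mul_eq_one hσ ?_
  obtain ⟨hre, him⟩ := Complex.nonneg_iff.1 (hρ.trace_mul_nonneg hσ)
  rw [born, idealClone, idealClone, ← Matrix.mul_kronecker_mul, Matrix.trace_kronecker,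
    Complex.mul_re, ← him, mul_zero, sub_zero] at h
  refine Complex.ext ?_ (by simp [← him])
  rw [Complex.one_re]
  nlinarith

theorem IsPure.born_idealClone_self {ρ : Op1} (hρ : IsPure ρ) :
    born (idealClone ρ) (idealClone ρ) = 1 := by
  rw [born, idealClone, ← Matrix.mul_kronecker_mul, Matrix.trace_kronecker, hρ.idem, hρ.trace]
  simp

theorem IsPure.trace_idealClone {ρ : Op1} (hρ : IsPure ρ) : (idealClone ρ).trace = 1 := by
  rw [idealClone, Matrix.trace_kronecker, hρ.trace, one_mul]

/-! ### The dimension of the span of the ideal clones -/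

/-- A real basis of the Hermitian operators on a qubit. -/
def hermBasis : Fin 4 → Op1 :=
  ![!![1, 0; 0, 0], !![0, 0; 0, 1], !![0, 1; 1, 0], !![0, Complex.I; -Complex.I, 0]]

/-- Symmetrized products of the basis operators. -/
def symBasis : Sym2 (Fin 4) → Op2 :=
  Sym2.lift ⟨fun k l => hermBasis k ⊗ₖ hermBasis l + hermBasis l ⊗ₖ hermBasis k,
    fun _ _ => add_comm _ _⟩

theorem exists_eq_sum_hermBasis {ρ : Op1} (hρ : ρ.IsHermitian) :
    ∃ c : Fin 4 → ℝ, ρ = ∑ k, c k • hermBasis k := by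
  have h00 := hρ.apply 0 0
  have h11 := hρ.apply 1 1
  have h10 := hρ.apply 1 0
  refine ⟨![(ρ 0 0).re, (ρ 1 1).re, (ρ 0 1).re, (ρ 0 1).im], ?_⟩
  ext i j
  fin_cases i <;> fin_cases j <;>
    simp [Fin.sum_univ_four, hermBasis, Complex.ext_iff] at h00 h11 h10 ⊢ <;>
    grind

/-- The coefficients `c k * c l` of a tensor square are symmetric in `k` and `l`, so only
symmetrized products contribute. -/
theorem idealClone_mem_span {ρ : Op1} (hρ : ρ.IsHermitian) :
    idealClone ρ ∈ Submodule.span ℝ (Set.range symBasis) := by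
  obtain ⟨c, hc⟩ := exists_eq_sum_hermBasis hρ
  have h1 : idealClone ρ = ∑ k, ∑ l, (c k * c l) • (hermBasis k ⊗ₖ hermBasis l) := by
    ext ⟨i, i'⟩ ⟨j, j'⟩
    simp only [idealClone, hc, Matrix.kroneckerMap_apply, Matrix.sum_apply, Matrix.smul_apply,
      Finset.sum_mul_sum, Complex.real_smul, Complex.ofReal_mul]
    exact Finset.sum_congr rfl fun _ _ => Finset.sum_congr rfl fun _ _ => by ring
  -- Averaging the expansion with its swapped copy produces the factor 1/2.
  have h2 : idealClone ρ = ∑ k, ∑ l, (c k * c l / 2) • symBasis s(k, l) := by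
    have h3 : idealClone ρ = ∑ k, ∑ l, (c k * c l) • (hermBasis l ⊗ₖ hermBasis k) := by
      rw [h1, Finset.sum_comm]
      exact Finset.sum_congr rfl fun _ _ => Finset.sum_congr rfl fun _ _ => by rw [mul_comm]
    have h4 : idealClone ρ = (1 / 2 : ℝ) • (idealClone ρ + idealClone ρ) := by
      rw [← two_smul ℝ, smul_smul]
      norm_num
    rw [h4]
    nth_rw 1 [h1]
    rw [h3]
    simp only [← Finset.sum_add_distrib, Finset.smul_sum, symBasis, Sym2.lift_mk, ← smul_add,
      smul_smul]
    exact Finset.sum_congr rfl fun _ _ => Finset.sum_congr rfl fun _ _ => by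
      rw [one_div_mul_eq_div]
  rw [h2]
  exact Submodule.sum_mem _ fun _ _ => Submodule.sum_mem _ fun _ _ =>
    Submodule.smul_mem _ _ (Submodule.subset_span ⟨_, rfl⟩)

/-- The ideal clones span a real space of dimension at most `10`. -/
theorem finrank_span_idealClone_le {ι : Type*} {a : ι → Op1} (ha : ∀ i, (a i).IsHermitian)
    (A : Set ι) :
    Module.finrank ℝ (Submodule.span ℝ ((fun i => idealClone (a i)) '' A)) ≤ 10 := by
  have hle : Submodule.span ℝ ((fun i => idealClone (a i)) '' A) ≤
      Submodule.span ℝ (Set.range symBasis) := by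
    rw [Submodule.span_le]
    rintro _ ⟨i, -, rfl⟩
    exact idealClone_mem_span (ha i)
  refine (Submodule.finrank_mono hle).trans ((finrank_range_le_card symBasis).trans ?_)
  -- There are 10 unordered pairs, with repetition, from four basis elements.
  rw [Sym2.card, Fintype.card_fin]
  decide

/-! ### Factorizations that respect operational equivalences -/

section Factorization

variable {P M K : Type*} [Fintype P] [Fintype M] [Fintype K]

/-- A fragment with the ideal clones of more than `2 ^ 9` pure states, and tests for them, has no
nonnegative factorization that respects the linear relations among its states and effects. -/
theorem no_linear_factorization (F : Fragment P M K) {N : ℕ} (hN : 2 ^ 10 < 2 * N)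
    {a : Fin N → Op1} (ha : Function.Injective a) (hp : ∀ i, IsPure (a i))
    (hideal : ∀ i, ∃ p, F.state p = idealClone (a i))
    (htest : ∀ i, ∃ m k, F.effect m k = idealClone (a i))
    {Λ : Type*} [Fintype Λ] (R : Matrix (M × K) Λ ℝ) (E : Matrix Λ P ℝ)
    (hR : ∀ e l, 0 ≤ R e l) (hE : ∀ l p, 0 ≤ E l p) (hC : F.cope = R * E)
    (hprep : ∀ w : P → ℝ, ∑ p, w p • F.state p = 0 → ∀ l, ∑ p, w p * E l p = 0)
    (hevent : ∀ w : M × K → ℝ, ∑ e, w e • F.effect e.1 e.2 = 0 → ∀ l, ∑ e, w e * R e l = 0) :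
    False := by
  choose ε hε using fun l => exists_functional_of_relations F.state (E l) fun w hw => hprep w hw l
  choose r hr using fun l => exists_functional_of_relations
    (fun e : M × K => F.effect e.1 e.2) (fun e => R e l) fun w hw => hevent w hw l
  choose p hpi using hideal
  choose m k hmk using htest
  have hborn : ∀ i q, born (F.effect (m i) (k i)) (F.state q)
      = ∑ l, R (m i, k i) l * E l q := fun i q => by
    simpa [Matrix.mul_apply, Fragment.cope] using congrFun (congrFun hC (m i, k i)) q
  -- An arbitrary nonnegative factorization is not normalized. By linearity the total response at
  -- `l` is nevertheless the same for all these measurements, and `r l 1` takes the place of 1.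
  have hone : ∀ i l, r l 1 = ∑ x, R (m i, x) l := fun i l => by
    rw [← F.effect_sum (m i), map_sum]
    exact Finset.sum_congr rfl fun x _ => hr l (m i, x)
  have hle : ∀ i l, R (m i, k i) l ≤ r l 1 := fun i l => by
    rw [hone i]
    exact Finset.single_le_sum (f := fun x => R (m i, x) l) (fun x _ => hR _ l)
      (Finset.mem_univ (k i))
  have htotal : ∀ j, ∑ l, r l 1 * E l (p j) = 1 := fun j => by
    have h1 : ∑ x, born (F.effect (m j) x) (F.state (p j)) = 1 := by
      have := born_sum_smul_left (fun _ => 1) (F.effect (m j)) (F.state (p j))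
      simp only [one_smul, one_mul] at this
      rw [← this, F.effect_sum, born, one_mul, (F.state_density _).2, Complex.one_re]
    rw [← h1]
    simp only [hone j, Finset.sum_mul]
    rw [Finset.sum_comm]
    refine Finset.sum_congr rfl fun x _ => ?_
    simpa [Matrix.mul_apply, Fragment.cope] using (congrFun (congrFun hC (m j, x)) (p j)).symm
  have hself : ∀ i l, ε l (idealClone (a i)) = 0 ∨ R (m i, k i) l = r l 1 := by
    intro i l
    have h1 : ∑ l, (r l 1 - R (m i, k i) l) * E l (p i) = 0 := by
      simp only [sub_mul, Finset.sum_sub_distrib]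
      rw [htotal, ← hborn, hmk, hpi, (hp i).born_idealClone_self, sub_self]
    have h2 := (Finset.sum_eq_zero_iff_of_nonneg fun l _ =>
      mul_nonneg (sub_nonneg.2 (hle i l)) (hE l (p i))).1 h1 l (Finset.mem_univ l)
    rw [← hpi, hε]
    exact (mul_eq_zero.1 h2).symm.imp_right fun h => (sub_eq_zero.1 h).symm
  -- the defect of the test of an ideal clone, as a functional of the clone
  let τ : Op2 →ₗ[ℝ] ℝ := Complex.reLm ∘ₗ Matrix.traceLinearMap (Fin 2 × Fin 2) ℝ ℂ
  let δ : Λ → Op2 →ₗ[ℝ] ℝ := fun l => r l 1 • τ - r l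
  have hδ : ∀ i l, δ l (idealClone (a i)) = r l 1 - R (m i, k i) l := fun i l => by
    have hτ : τ (idealClone (a i)) = 1 := by
      simp [τ, (hp i).trace_idealClone]
    rw [← hr l (m i, k i), LinearMap.sub_apply, LinearMap.smul_apply, hτ, hmk, smul_eq_mul,
      mul_one]
  have hne : ∀ i, idealClone (a i) ≠ 0 := fun i h => by
    simpa [h] using (hp i).trace_idealClone
  obtain ⟨B, hB, hvan⟩ := exists_subset_forall_vanish (fun i => idealClone (a i)) hne ε δ
    (fun l i => (hself i l).imp_right fun h => by rw [hδ, h, sub_self]) 10 Finset.univ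
    (finrank_span_idealClone_le (fun i => (hp i).herm) _) (by simpa using hN)
  obtain ⟨i, hi, j, hj, hij⟩ := Finset.one_lt_card.1 hB
  refine hij (ha ((hp i).eq_of_born_idealClone_eq_one (hp j) ?_))
  rw [← hmk i, ← hpi j, hborn, ← htotal j]
  refine Finset.sum_congr rfl fun l _ => ?_
  rcases hvan l with h | h
  · have h0 := h j hj
    rw [← hpi, hε] at h0
    rw [h0, mul_zero, mul_zero]
  · have h0 := h i hi
    rw [hδ] at h0
    rw [sub_eq_zero.1 h0]

/-- A small positive multiple of a real weight vector is at most one in absolute value. -/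
theorem exists_pos_forall_nonneg_add {ι : Type*} [Fintype ι] (w : ι → ℝ) :
    ∃ c : ℝ, 0 < c ∧ (∀ i, 0 ≤ 1 + c * w i) ∧ ∀ i, c * w i ≤ 1 := by
  have hS : 0 ≤ ∑ i, |w i| := Finset.sum_nonneg fun _ _ => abs_nonneg _
  -- The summand 1 keeps the denominator positive even for `w = 0`.
  have h : ∀ i, |(1 + ∑ i, |w i|)⁻¹ * w i| ≤ 1 := fun i => by
    have hi : |w i| ≤ ∑ i, |w i| :=
      Finset.single_le_sum (f := fun i => |w i|) (fun _ _ => abs_nonneg _) (Finset.mem_univ i)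
    rw [abs_mul, abs_of_pos (by positivity), inv_mul_le_one₀ (by positivity)]
    linarith
  exact ⟨(1 + ∑ i, |w i|)⁻¹, by positivity, fun i => by linarith [(abs_le.1 (h i)).1],
    fun i => (abs_le.1 (h i)).2⟩

/-- The epistemic states of a noncontextual model respect all linear relations among the states. -/
theorem OntologicalModel.IsNoncontextual.epistemic_relation {F : Fragment P M K} {Λ : Type*}
    [Fintype Λ] {O : OntologicalModel F Λ} (hO : O.IsNoncontextual) (w : P → ℝ)
    (hw : ∑ p, w p • F.state p = 0) (l : Λ) : ∑ p, w p * O.epistemic l p = 0 := by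
  rcases isEmpty_or_nonempty P with hP | hP
  · simp
  -- Taking the trace of the relation, since all states have trace one.
  have hsum : ∑ p, w p = 0 := by
    have h := born_sum_smul_right w 1 F.state
    rw [hw] at h
    simpa [born, (F.state_density _).2] using h.symm
  obtain ⟨c, hc, hpos, -⟩ := exists_pos_forall_nonneg_add w
  have hn : (0 : ℝ) < Fintype.card P := by exact_mod_cast Fintype.card_pos
  set n : ℝ := (Fintype.card P : ℝ) with hn_def
  -- The uniform mixture and its small perturbation along `w` are genuine, operationally equivalent
  -- mixtures; their difference is a multiple of the relation.
  have h := hO.prep (fun p => n⁻¹ * (1 + c * w p)) (fun _ => n⁻¹)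
    (fun p => mul_nonneg (by positivity) (hpos p)) (fun _ => by positivity)
    (by
      rw [← Finset.mul_sum, Finset.sum_add_distrib, ← Finset.mul_sum, hsum]
      simp [← hn_def, hn.ne'])
    (by simp [← hn_def, hn.ne'])
    (fun T _ => by
      have h0 : ∑ p, w p * born T (F.state p) = 0 := by
        rw [← born_sum_smul_right, hw]
        simp [born]
      simp only [mul_add, add_mul, mul_one, Finset.sum_add_distrib, add_eq_left]
      rw [← mul_zero (n⁻¹ * c), ← h0, Finset.mul_sum]
      exact Finset.sum_congr rfl fun _ _ => by ring) l
  simp only [mul_add, add_mul, mul_one, Finset.sum_add_distrib, add_eq_left] at h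
  have h1 : n⁻¹ * c * ∑ p, w p * O.epistemic l p = 0 := by
    rw [← h, Finset.mul_sum]
    exact Finset.sum_congr rfl fun _ _ => by ring
  exact (mul_eq_zero.1 h1).resolve_left (by positivity)

/-- The responses of a noncontextual model respect all linear relations among the effects. -/
theorem OntologicalModel.IsNoncontextual.response_relation {F : Fragment P M K} {Λ : Type*}
    [Fintype Λ] {O : OntologicalModel F Λ} (hO : O.IsNoncontextual) (w : M × K → ℝ)
    (hw : ∑ e, w e • F.effect e.1 e.2 = 0) (l : Λ) : ∑ e, w e * O.response e l = 0 := by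
  rcases isEmpty_or_nonempty (M × K) with hP | hP
  · simp
  obtain ⟨c, hc, hpos, hle⟩ := exists_pos_forall_nonneg_add w
  have hn : (0 : ℝ) < Fintype.card (M × K) := by exact_mod_cast Fintype.card_pos
  set n : ℝ := (Fintype.card (M × K) : ℝ) with hn_def
  -- The weights of a relation among effects need not sum to zero, so the perturbed weights are only
  -- bounded by 2. The extra factor 1/2 makes both mixtures sub-normalized.
  have hsum : ∀ f : M × K → ℝ, (∀ e, f e ≤ 2) → ∑ e, (2 * n)⁻¹ * f e ≤ 1 := fun f hf => by
    rw [← Finset.mul_sum, inv_mul_le_one₀ (by positivity)]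
    refine (Finset.sum_le_card_nsmul _ _ 2 fun e _ => hf e).trans_eq ?_
    rw [Finset.card_univ, nsmul_eq_mul, ← hn_def, mul_comm]
  have h := hO.event (fun e => (2 * n)⁻¹ * (1 + c * w e)) (fun _ => (2 * n)⁻¹ * 1)
    (fun e => mul_nonneg (by positivity) (hpos e)) (fun _ => by positivity)
    (hsum _ fun e => by linarith [hle e]) (hsum _ fun _ => by norm_num)
    (fun ρ _ => by
      have h0 : ∑ e, w e * born (F.effect e.1 e.2) ρ = 0 := by
        rw [← born_sum_smul_left w (fun e : M × K => F.effect e.1 e.2), hw]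
        simp [born]
      simp only [mul_add, add_mul, Finset.sum_add_distrib, add_eq_left]
      rw [← mul_zero ((2 * n)⁻¹ * c), ← h0, Finset.mul_sum]
      exact Finset.sum_congr rfl fun _ _ => by ring) l
  simp only [mul_add, add_mul, Finset.sum_add_distrib, add_eq_left] at h
  have h1 : (2 * n)⁻¹ * c * ∑ e, w e * O.response e l = 0 := by
    rw [← h, Finset.mul_sum]
    exact Finset.sum_congr rfl fun _ _ => by ring
  exact (mul_eq_zero.1 h1).resolve_left (by positivity)

end Factorization

/-- Linear relations among the states annihilate the columns of the matrix of probabilities. -/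
theorem Fragment.cope_mulVec_eq_zero {P M K : Type*} [Fintype P] [Fintype K]
    (F : Fragment P M K) {w : P → ℝ}
    (hw : ∑ p, w p • F.state p = 0) : F.cope.mulVec w = 0 := by
  ext e
  have h := born_sum_smul_right w (F.effect e.1 e.2) F.state
  rw [hw] at h
  simpa [born, Matrix.mulVec, dotProduct, Fragment.cope, mul_comm] using h.symm

/-- Linear relations among the effects annihilate the rows of the matrix of probabilities. -/
theorem Fragment.cope_transpose_mulVec_eq_zero {P M K : Type*} [Fintype M] [Fintype K]
    (F : Fragment P M K) {w : M × K → ℝ}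
    (hw : ∑ e, w e • F.effect e.1 e.2 = 0) : F.cope.transpose.mulVec w = 0 := by
  ext p
  have h := born_sum_smul_left w (fun e : M × K => F.effect e.1 e.2) (F.state p)
  rw [hw] at h
  simpa [born, Matrix.mulVec, dotProduct, Fragment.cope, mul_comm] using h.symm

end QCloning

theorem theorem4 (t : QCloning.Task)
    (b : QCloning.Op1) (hb : QCloning.IsDensity b)
    (Φ : QCloning.Op2 →ₗ[ℂ] QCloning.Op2) (hΦ : t.IsOptimalCloner Φ b)
    (N : ℕ) (hN : 12155 ≤ N) (a : Fin N → QCloning.Op1)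
    (ha : Function.Injective a) (hat : ∀ i, a i ∈ t.inputs)
    {P M K : Type*} [Fintype P] [Fintype M] [Fintype K]
    (F : QCloning.Fragment P M K) (hF : F.ContainsCloning Φ b a) :
    (∀ (Λ : Type) [Fintype Λ] (O : QCloning.OntologicalModel F Λ), ¬ O.IsNoncontextual) ∧
      ¬ QCloning.AdmitsENMF F.cope := by
  classical
  -- The halving argument in dimension 10 needs only `N > 512`.
  have hN' : 2 ^ 10 < 2 * N := by omega
  have hp := fun i => QCloning.isPure_of_mem_inputs (hat i)
  constructor
  · intro Λ _ O hO
    exact QCloning.no_linear_factorization F hN' ha hp hF.ideal hF.test O.response O.epistemic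
      O.response_nonneg O.epistemic_nonneg O.reproduces hO.epistemic_relation
      hO.response_relation
  · rintro ⟨s, R, E, hR, hE, hC, hrR, hrE⟩
    refine QCloning.no_linear_factorization F hN' ha hp hF.ideal hF.test R E hR hE hC ?_ ?_
    · intro w hw l
      have h := congrFun
        (QCloning.mulVec_eq_zero_of_rank_eq hC hrE (F.cope_mulVec_eq_zero hw)) l
      simpa [Matrix.mulVec, dotProduct, mul_comm] using h
    · intro w hw l
      -- Transposition turns the left factor into a right factor, so the same kernel argument
      -- applies to relations among effects.
      have hC' : F.cope.transpose = E.transpose * R.transpose := by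
        rw [hC, Matrix.transpose_mul]
      have h := congrFun (QCloning.mulVec_eq_zero_of_rank_eq hC'
        (by rw [Matrix.rank_transpose, Matrix.rank_transpose, hrR])
        (F.cope_transpose_mulVec_eq_zero hw)) l
      simpa [Matrix.mulVec, dotProduct, mul_comm] using h
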